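/- A \emph{quandle} is a set $Q$ with two binary operations $*,\backslash$ such that $x\backslash(x*y)=y=x*(x\backslash y)$, $x*(y*z)=(x*y)*(x*z)$ and $x*x=x$ for all $x,y,z\in Q$; write $L_a\colon b\mapsto a*b$ and $R_a\colon b\mapsto b*a$. The quandle $Q$ is \emph{involutory} if $x*(x*y)=y$ for all $x,y$; \emph{latin} if every $R_a$ is bijective; \emph{faithful} if $L_a=L_b$ implies $a=b$; \emph{connected} if the group $\langle L_a : a\in Q\rangle$ acts transitively on $Q$. A \emph{congruence} of $Q$ is an equivalence relation compatible with both $*$ and $\backslash$; let $0_Q$ be equality and $1_Q=Q\times Q$. For congruences $\alpha,\beta$, the commutator $[\alpha,\beta]$ is the smallest congruence $\delta$ such that for all $m,n\ge 0$, every $(m+n)$-ary term $t$ in the operations $*,\backslash$ and all tuples with $a_i\,\alpha\,b_i$ ($1\le i\le m$) and $u_j\,\beta\,v_j$ ($1\le j\le n$), $$t(a,u)\,\delta\,t(a,v)\ \Longrightarrow\ t(b,u)\,\delta\,t(b,v).$$ Put $\gamma_0(Q)=1_Q$ and $\gamma_{k+1}(Q)=[\gamma_k(Q),1_Q]$. The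 quandle $Q$ is \emph{nilpotent} if $\gamma_k(Q)=0_Q$ for some $k\ge 0$. \textbf{Theorem.} Let $Q$ be a finite nilpotent involutory quandle. Then $Q$ is latin if and only if $Q$ is connected and faithful. -/

import Mathlib

open scoped Quandles

namespace Rack

/-- A congruence of the left quasigroup `(Q, ◃, ◃⁻¹)` underlying a rack: an equivalence relation
compatible with both the multiplication and the left division. -/
@[ext]
structure Congruence (Q : Type*) [Rack Q] extends Setoid Q where
  act_rel : ∀ {a b c d : Q}, r a b → r c d → r (a ◃ c) (b ◃ d)
  invAct_rel : ∀ {a b c d : Q}, r a b → r c d → r (a ◃⁻¹ c) (b ◃⁻¹ d)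

/-- Terms in the language of left quasigroups, with variables indexed by `ι`. -/
inductive Term (ι : Type) : Type
  | var : ι → Term ι
  | mul : Term ι → Term ι → Term ι
  | ldiv : Term ι → Term ι → Term ι

/-- The term operation of a rack defined by a term. -/
def Term.eval {Q : Type*} [Rack Q] {ι : Type} : Term ι → (ι → Q) → Q
  | .var i, x => x i
  | .mul s t, x => s.eval x ◃ t.eval x
  | .ldiv s t, x => s.eval x ◃⁻¹ t.eval x

namespace Congruence

variable {Q : Type*} [Rack Q]

/-- The smallest congruence `0_Q`: equality. -/
def zero (Q : Type*) [Rack Q] : Congruence Q where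
  toSetoid := ⊥
  act_rel := by rintro a _ c _ rfl rfl; rfl
  invAct_rel := by rintro a _ c _ rfl rfl; rfl

/-- The largest congruence `1_Q = Q × Q`. -/
def one (Q : Type*) [Rack Q] : Congruence Q where
  toSetoid := ⊤
  act_rel := fun _ _ => trivial
  invAct_rel := fun _ _ => trivial

/-- The term condition `C(α, β; δ)`: `α` centralizes `β` modulo `δ`, i.e. for every term `t`, all
tuples `a α b` and `u β v` (componentwise), `t(a, u) δ t(a, v)` implies `t(b, u) δ t(b, v)`. -/
def Centralizes (α β δ : Congruence Q) : Prop :=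
  ∀ (m n : ℕ) (t : Term (Fin m ⊕ Fin n)) (a b : Fin m → Q) (u v : Fin n → Q),
    (∀ i, α.r (a i) (b i)) → (∀ j, β.r (u j) (v j)) →
    δ.r (t.eval (Sum.elim a u)) (t.eval (Sum.elim a v)) →
    δ.r (t.eval (Sum.elim b u)) (t.eval (Sum.elim b v))

/-- The commutator `[α, β]`: the smallest congruence `δ` such that `α` centralizes `β` modulo `δ`,
obtained as the intersection of all of them. -/
def commutator (α β : Congruence Q) : Congruence Q where
  r x y := ∀ δ : Congruence Q, Centralizes α β δ → δ.r x y
  iseqv :=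
    { refl := fun x δ _ => δ.iseqv.refl x
      symm := fun h δ hδ => δ.iseqv.symm (h δ hδ)
      trans := fun h k δ hδ => δ.iseqv.trans (h δ hδ) (k δ hδ) }
  act_rel := fun h k δ hδ => δ.act_rel (h δ hδ) (k δ hδ)
  invAct_rel := fun h k δ hδ => δ.invAct_rel (h δ hδ) (k δ hδ)

/-- The commutator itself satisfies the term condition, so it is indeed the smallest congruence
that does. -/
theorem centralizes_commutator (α β : Congruence Q) : Centralizes α β (commutator α β) :=
  fun m n t a b u v hab huv h δ hδ => hδ m n t a b u v hab huv (h δ hδ)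

/-- The lower central series `γ_0(Q) = 1_Q`, `γ_{n+1}(Q) = [γ_n(Q), 1_Q]`. -/
def lowerCentralSeries (Q : Type*) [Rack Q] : ℕ → Congruence Q
  | 0 => one Q
  | n + 1 => commutator (lowerCentralSeries Q n) (one Q)

end Congruence

/-- `Q` is nilpotent if its lower central series of congruences reaches `0_Q`. -/
def IsNilpotent (Q : Type*) [Rack Q] : Prop :=
  ∃ n : ℕ, Congruence.lowerCentralSeries Q n = Congruence.zero Q

/-- The left multiplication group, generated by the left multiplications `L_a : b ↦ a ◃ b`. -/
def leftMulGroup (Q : Type*) [Rack Q] : Subgroup (Equiv.Perm Q) :=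
  Subgroup.closure (Set.range fun a : Q => (act' a : Equiv.Perm Q))

/-- `Q` is connected if the left multiplication group acts transitively on `Q`. -/
def IsConnected (Q : Type*) [Rack Q] : Prop :=
  MulAction.IsPretransitive (leftMulGroup Q) Q

/-- `Q` is faithful if `L_a = L_b` implies `a = b`. -/
def IsFaithful (Q : Type*) [Rack Q] : Prop :=
  Function.Injective fun a : Q => (act' a : Equiv.Perm Q)

/-- `Q` is latin if also the right multiplications `R_a : b ↦ b ◃ a` are bijective. -/
def IsLatin (Q : Type*) [Rack Q] : Prop :=
  ∀ a : Q, Function.Bijective fun b : Q => b ◃ a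

end Rack

/-!
The left-to-right implication is formal. For the converse, let `Dis(Q)` be the displacement group,
generated by all `L_a L_b⁻¹`.

* If `Q` is nilpotent, then `Dis(Q)` is a nilpotent group (`Rack.isNilpotent_disGroup`). For a
  congruence `α`, let `K_α ≤ Dis(Q)` consist of the elements moving every point inside its
  `α`-class. If `h ∈ K_α` and `g ∈ Dis(Q)`, then `⁅h, g⁆` is a product of conjugates of elements
  `L_p L_q⁻¹` with `p α q`, and when `α` centralizes `1_Q` modulo `δ`, the term condition for
  `y \ (x * (x' \ (y * z)))` says that such elements commute with `Dis(Q)` modulo `K_δ`. So two steps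
  of the lower central series of the group cost one step of the lower central series of `Q`.
* If `Q` is a connected involutory quandle, conjugation by `L_e` inverts the generators `L_a L_e` of
  `Dis(Q)`, hence acts by inversion on the abelianization. As `a = g e` for some `g ∈ Dis(Q)`,
  the generator `L_a L_e = g (L_e g⁻¹ L_e)` becomes the square of `g` there, so squaring is onto
  on the abelianization (`Rack.exists_sq_eq_abelianization_disGroup`). A finite nilpotent group with
  this property has odd order, since it has no nontrivial `2`-group as a quotient
  (`Group.coprime_card_of_pow_surjective_abelianization`).
* If `a * e = b * e = c`, then `(L_a L_e)² = L_c L_e = (L_b L_e)²`; squaring is injective in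
  a group of odd order, so `L_a = L_b`, and `a = b` by faithfulness. Thus `R_e` is injective,
  and bijective by finiteness.
-/

/-! ### Group theory -/

open scoped commutatorElement

theorem perm_apply_inv_self {α : Type*} (g : Equiv.Perm α) (x : α) : g (g⁻¹ x) = x :=
  g.apply_symm_apply x

theorem Subgroup.normal_upperCentralSeriesStep {G : Type*} [Group G] (N : Subgroup G) [N.Normal] :
    N.upperCentralSeriesStep.Normal := by
  rw [Subgroup.upperCentralSeriesStep_eq_comap_center]
  infer_instance

theorem Subgroup.commutatorElement_mem_of_closure_eq_top {G : Type*} [Group G] {N : Subgroup G}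
    [N.Normal] {S : Set G} (hS : Subgroup.closure S = ⊤) {h : G} (H : ∀ s ∈ S, ⁅h, s⁆ ∈ N) (g : G) :
    ⁅h, g⁆ ∈ N := by
  have key (x : G) : ⁅h, x⁆ ∈ N ↔
      x ∈ (Subgroup.centralizer {(h : G ⧸ N)}).comap (QuotientGroup.mk' N) := by
    rw [Subgroup.mem_comap, Subgroup.mem_centralizer_singleton_iff, ← QuotientGroup.eq_one_iff,
      eq_comm (b := (h : G ⧸ N) * _)]
    exact commutatorElement_eq_one_iff_mul_comm (g₁ := (h : G ⧸ N)) (g₂ := (x : G ⧸ N))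
  rw [key]
  exact (Subgroup.closure_le _).2 (fun s hs => (key s).1 (H s hs)) (hS ▸ Subgroup.mem_top g)

theorem IsPGroup.subsingleton_of_pow_surjective {p : ℕ} [Fact p.Prime] {A : Type*} [Group A]
    [Finite A] (hA : IsPGroup p A) (h : ∀ x : A, ∃ y : A, y ^ p = x) : Subsingleton A := by
  by_contra hn
  rw [not_subsingleton_iff_nontrivial] at hn
  obtain ⟨n, hn0, hn⟩ := hA.nontrivial_iff_card.1 hn
  obtain ⟨x, hx⟩ := exists_prime_orderOf_dvd_card' p (hn ▸ dvd_pow_self p hn0.ne')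
  have hinj : Function.Injective fun y : A => y ^ p := Finite.injective_iff_surjective.2 h
  have hx1 : x = 1 := hinj (by simp [← hx, pow_orderOf_eq_one])
  rw [hx1, orderOf_one] at hx
  exact (Fact.out : p.Prime).one_lt.ne hx

/-- A finite nilpotent group maps onto its Sylow `p`-subgroup; if `p`-th powers are onto on the
abelianization, this `p`-group is perfect, hence trivial. -/
theorem Group.coprime_card_of_pow_surjective_abelianization {G : Type*} [Group G] [Finite G]
    [Group.IsNilpotent G] {p : ℕ} [Fact p.Prime]
    (h : ∀ x : Abelianization G, ∃ y, y ^ p = x) : (Nat.card G).Coprime p := by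
  rw [Nat.coprime_comm, Nat.Prime.coprime_iff_not_dvd Fact.out]
  intro hp
  let e := Sylow.directProductOfNormal (G := G) fun {p _} P => inferInstance
  let q : (Nat.card G).primeFactors := ⟨p, Nat.mem_primeFactors.2 ⟨Fact.out, hp, Nat.card_pos.ne'⟩⟩
  obtain ⟨P⟩ : Nonempty (Sylow p G) := inferInstance
  let f : G →* P := ((Pi.evalMonoidHom _ P).comp
    (Pi.evalMonoidHom (fun p : (Nat.card G).primeFactors => ∀ P : Sylow p G, P) q)).comp
      e.symm.toMonoidHom
  have hf : Function.Surjective f := by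
    classical
    intro x
    refine ⟨e (Pi.mulSingle q (Pi.mulSingle P x)), ?_⟩
    simp [f]
  have hPA : IsPGroup p (Abelianization P) := P.2.of_surjective Abelianization.of
    (QuotientGroup.mk'_surjective _)
  have hsub : Subsingleton (Abelianization P) := by
    refine hPA.subsingleton_of_pow_surjective fun x => ?_
    obtain ⟨x, rfl⟩ := QuotientGroup.mk'_surjective _ x
    obtain ⟨g, rfl⟩ := hf x
    obtain ⟨y, hy⟩ := h (Abelianization.of g)
    exact ⟨Abelianization.map f y, by rw [← map_pow, hy]; rfl⟩
  have hnil : Group.IsNilpotent P := P.2.isNilpotent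
  have hcomm : commutator P = ⊤ := by
    rw [eq_top_iff]
    intro x _
    exact (QuotientGroup.eq_one_iff x).1 (Subsingleton.elim (α := Abelianization P) _ _)
  have hnt : Nontrivial P := by
    rw [Subgroup.nontrivial_iff_ne_bot]
    exact P.ne_bot_of_dvd_card hp
  exact (IsSolvable.commutator_lt_top_of_nontrivial P).ne hcomm

namespace Rack

/-! ### The displacement group -/

section Rack

variable {Q : Type*} [Rack Q]

variable (Q) in
/-- The displacement group, generated by the permutations `L_a L_b⁻¹`. -/
def disGroup : Subgroup (Equiv.Perm Q) :=
  Subgroup.closure {g | ∃ a b : Q, g = act' a * (act' b)⁻¹}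

theorem act'_mul_inv_mem_disGroup (a b : Q) : act' a * (act' b)⁻¹ ∈ disGroup Q :=
  Subgroup.subset_closure ⟨a, b, rfl⟩

/-- The generator `L_a L_b⁻¹` of the displacement group. -/
def disGroup.gen (a b : Q) : disGroup Q := ⟨_, act'_mul_inv_mem_disGroup a b⟩

theorem disGroup.closure_gen :
    Subgroup.closure {g : disGroup Q | ∃ a b : Q, g = gen a b} = ⊤ := by
  refine Eq.trans ?_ (Subgroup.closure_closure_coe_preimage
    (k := {g : Equiv.Perm Q | ∃ a b : Q, g = act' a * (act' b)⁻¹}))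
  congr 1
  ext g
  simp only [Set.mem_ofPred_eq, Subtype.ext_iff]
  rfl

theorem act'_mem_leftMulGroup (a : Q) : act' a ∈ leftMulGroup Q :=
  Subgroup.subset_closure ⟨a, rfl⟩

theorem disGroup_le_leftMulGroup : disGroup Q ≤ leftMulGroup Q := by
  rw [disGroup, Subgroup.closure_le]
  rintro _ ⟨a, b, rfl⟩
  exact mul_mem (act'_mem_leftMulGroup a) (inv_mem (act'_mem_leftMulGroup b))

theorem act'_perm_apply {g : Equiv.Perm Q} (hg : g ∈ leftMulGroup Q) (a : Q) :
    act' (g a) = g * act' a * g⁻¹ := by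
  induction hg using Subgroup.closure_induction generalizing a with
  | mem x hx => obtain ⟨b, rfl⟩ := hx; exact ad_conj b a
  | one => simp
  | mul x y _ _ hx hy => rw [Equiv.Perm.mul_apply, hx, hy]; group
  | inv x _ hx =>
    have := hx (x⁻¹ a)
    rw [perm_apply_inv_self] at this
    rw [this]; group

theorem Congruence.rel_perm_apply (α : Congruence Q) {g : Equiv.Perm Q}
    (hg : g ∈ leftMulGroup Q) {x y : Q} (h : α.r x y) : α.r (g x) (g y) := by
  have key : ∀ x y : Q, α.r x y → α.r (g x) (g y) ∧ α.r (g⁻¹ x) (g⁻¹ y) := by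
    induction hg using Subgroup.closure_induction with
    | mem x hx =>
      obtain ⟨b, rfl⟩ := hx
      exact fun x y h => ⟨α.act_rel (α.iseqv.refl b) h, α.invAct_rel (α.iseqv.refl b) h⟩
    | one => exact fun x y h => ⟨h, by simpa using h⟩
    | mul u v _ _ hu hv =>
      intro x y h
      rw [mul_inv_rev]
      exact ⟨(hu _ _ (hv _ _ h).1).1, (hv _ _ (hu _ _ h).2).2⟩
    | inv u _ hu =>
      intro x y h
      rw [inv_inv]
      exact (hu x y h).symm
  exact (key x y h).1

/-! ### Nilpotence of the displacement group -/

/-- The subgroup of the displacement group consisting of the elements that act trivially on the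
quotient by `α`, that is, move every point inside its `α`-class. -/
def Congruence.disKer (α : Congruence Q) : Subgroup (disGroup Q) where
  carrier := {g | ∀ x, α.r (g.1 x) x}
  one_mem' := fun x => α.iseqv.refl x
  mul_mem' := fun {g h} hg hh x => α.iseqv.trans (hg (h.1 x)) (hh x)
  inv_mem' := fun {g} hg x => by
    have := hg (g⁻¹.1 x)
    rw [InvMemClass.coe_inv, perm_apply_inv_self] at this
    exact α.iseqv.symm this

theorem Congruence.mem_disKer {α : Congruence Q} {g : disGroup Q} :
    g ∈ α.disKer ↔ ∀ x, α.r (g.1 x) x := Iff.rfl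

instance (α : Congruence Q) : α.disKer.Normal where
  conj_mem n hn g x := by
    have := α.rel_perm_apply (disGroup_le_leftMulGroup g.2) (hn (g⁻¹.1 x))
    rwa [InvMemClass.coe_inv, perm_apply_inv_self] at this

/-- The term condition for `y \ (x * (x' \ (y * z)))`, with `(x, x')` moved from `(b, b)` to `(a, b)`
and `y` from `c` to `d`. -/
theorem Congruence.Centralizes.commutatorElement_gen_mem {α δ : Congruence Q}
    (h : Centralizes α (one Q) δ) {a b : Q} (hab : α.r a b) (c d : Q) :
    ⁅disGroup.gen a b, disGroup.gen c d⁆ ∈ δ.disKer := by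
  have key (z : Q) : δ.r (c ◃⁻¹ (a ◃ (b ◃⁻¹ (c ◃ z)))) (d ◃⁻¹ (a ◃ (b ◃⁻¹ (d ◃ z)))) := by
    let x₁ : Term (Fin 2 ⊕ Fin 2) := .var (.inl 0)
    let x₂ : Term (Fin 2 ⊕ Fin 2) := .var (.inl 1)
    let y : Term (Fin 2 ⊕ Fin 2) := .var (.inr 0)
    let w : Term (Fin 2 ⊕ Fin 2) := .var (.inr 1)
    have := h 2 2 (.ldiv y (.mul x₁ (.ldiv x₂ (.mul y w)))) ![b, b] ![a, b] ![c, z] ![d, z]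
      (by
        intro i
        fin_cases i
        · exact α.iseqv.symm hab
        · exact α.iseqv.refl b)
      (fun _ => trivial)
    simp only [Term.eval, x₁, x₂, y, w, Sum.elim_inl, Sum.elim_inr, Matrix.cons_val_zero,
      Matrix.cons_val_one, act_invAct_eq, invAct_act_eq] at this
    exact this (δ.iseqv.refl z)
  rw [mem_disKer]
  intro w
  have hw := δ.act_rel (δ.iseqv.refl c) (key (d ◃⁻¹ (b ◃ (a ◃⁻¹ (d ◃ (c ◃⁻¹ w))))))
  simp only [act_invAct_eq, invAct_act_eq] at hw
  simpa [commutatorElement_def, disGroup.gen] using hw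

/-- Both factors on the right are, up to conjugation, of the form `L_p L_q⁻¹` with `p` and `q`
in the same class of any congruence `α` with `h ∈ α.disKer`. -/
theorem disGroup.commutatorElement_gen (h : disGroup Q) (a b : Q) :
    ⁅h, gen a b⁆ = gen (h.1 a) a * (gen a (h.1 b) * gen b (h.1 b) * (gen a (h.1 b))⁻¹) := by
  have hL := disGroup_le_leftMulGroup h.2
  apply Subtype.ext
  simp only [commutatorElement_def, gen, Subgroup.coe_mul, InvMemClass.coe_inv,
    act'_perm_apply hL]
  group

theorem Congruence.Centralizes.commutatorElement_mem {α δ : Congruence Q}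
    (h : Centralizes α (one Q) δ) {k : disGroup Q} (hk : k ∈ α.disKer) (g : disGroup Q) :
    ⁅k, g⁆ ∈ δ.disKer.upperCentralSeriesStep := by
  have := Subgroup.normal_upperCentralSeriesStep δ.disKer
  have hgen {a b : Q} (hab : α.r a b) : disGroup.gen a b ∈ δ.disKer.upperCentralSeriesStep :=
    fun g => Subgroup.commutatorElement_mem_of_closure_eq_top disGroup.closure_gen
      (by rintro _ ⟨c, d, rfl⟩; exact h.commutatorElement_gen_mem hab c d) g
  refine Subgroup.commutatorElement_mem_of_closure_eq_top disGroup.closure_gen ?_ g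
  rintro _ ⟨a, b, rfl⟩
  rw [disGroup.commutatorElement_gen]
  exact mul_mem (hgen (hk a)) (this.conj_mem _ (hgen (α.iseqv.symm (hk b))) _)

theorem lowerCentralSeries_disGroup_le (n : ℕ) :
    (⊤ : Subgroup (disGroup Q)).lowerCentralSeries (2 * n) ≤
      (Congruence.lowerCentralSeries Q n).disKer := by
  induction n with
  | zero => exact fun g _ x => trivial
  | succ n ih =>
    have h := Congruence.centralizes_commutator (Congruence.lowerCentralSeries Q n)
      (Congruence.one Q)
    rw [mul_add, mul_one, Subgroup.lowerCentralSeries_succ, Subgroup.commutator_le]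
    intro k hk g _
    refine (?_ : _ ≤ Subgroup.upperCentralSeriesStep _) hk g
    rw [Subgroup.lowerCentralSeries_succ, Subgroup.commutator_le]
    exact fun k hk g _ => h.commutatorElement_mem (ih hk) g

theorem isNilpotent_disGroup (h : IsNilpotent Q) : Group.IsNilpotent (disGroup Q) := by
  obtain ⟨n, hn⟩ := h
  rw [Subgroup.nilpotent_iff_lowerCentralSeries]
  refine ⟨2 * n, eq_bot_iff.2 fun g hg => ?_⟩
  have := lowerCentralSeries_disGroup_le n hg
  rw [hn] at this
  exact Subgroup.mem_bot.2 (Subtype.ext (Equiv.ext this))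

end Rack

/-! ### Connected involutory quandles -/

section Quandle

variable {Q : Type*} [Quandle Q]

/-- Since `L_e` fixes `e` and normalizes the displacement group, the left multiplication group and
the displacement group have the same orbit through `e`. -/
theorem IsConnected.exists_disGroup (h : IsConnected Q) (e a : Q) :
    ∃ g : disGroup Q, g.1 e = a := by
  obtain ⟨⟨g, hg⟩, hga⟩ := h.exists_smul_eq e a
  replace hga : g e = a := hga
  subst hga
  have key : ∀ x : Q, ∃ d : disGroup Q, d.1 x = g x := by
    induction hg using Subgroup.closure_induction with
    | mem u hu =>
      obtain ⟨b, rfl⟩ := hu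
      refine fun x => ⟨disGroup.gen b x, ?_⟩
      simp [disGroup.gen]
    | one => exact fun x => ⟨1, rfl⟩
    | mul u v _ _ hu hv =>
      intro x
      obtain ⟨d, hd⟩ := hv x
      obtain ⟨d', hd'⟩ := hu (v x)
      exact ⟨d' * d, by simp [hd, hd']⟩
    | inv u _ hu =>
      intro x
      obtain ⟨d, hd⟩ := hu (u⁻¹ x)
      refine ⟨d⁻¹, ?_⟩
      rw [InvMemClass.coe_inv, Equiv.Perm.inv_eq_iff_eq, hd, perm_apply_inv_self]
  exact key e

theorem IsInvolutory.act'_inv (h : IsInvolutory Q) (a : Q) : (act' a)⁻¹ = act' a :=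
  Equiv.ext fun x => involutory_invAct_eq_act h a x

theorem IsInvolutory.act'_mul_self (h : IsInvolutory Q) (a : Q) : act' a * act' a = 1 :=
  Equiv.ext fun x => h a x

/-- In an involutory quandle, conjugation by `L_e` preserves the displacement group and inverts its
image in every commutative group. -/
theorem IsInvolutory.exists_conj_disGroup (h : IsInvolutory Q) {A : Type*} [CommGroup A]
    (φ : disGroup Q →* A) (e : Q) (g : disGroup Q) :
    ∃ g' : disGroup Q, g'.1 = act' e * g.1 * act' e ∧ φ g' = (φ g)⁻¹ := by
  have hg : g ∈ Subgroup.closure {g : disGroup Q | ∃ a b : Q, g = disGroup.gen a b} :=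
    disGroup.closure_gen (Q := Q) ▸ Subgroup.mem_top g
  have hE := h.act'_mul_self e
  induction hg using Subgroup.closure_induction with
  | mem u hu =>
    obtain ⟨a, b, rfl⟩ := hu
    have e1 : disGroup.gen e a = (disGroup.gen a e)⁻¹ := by
      apply Subtype.ext
      simp [disGroup.gen]
    refine ⟨disGroup.gen e a * disGroup.gen b e, ?_, ?_⟩
    · simp [disGroup.gen, h.act'_inv, mul_assoc]
    · have e2 : disGroup.gen a b = disGroup.gen a e * (disGroup.gen b e)⁻¹ := by
        apply Subtype.ext
        simp [disGroup.gen]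
      rw [e1, e2]
      simp [mul_comm]
  | one => exact ⟨1, by simp [hE], by simp⟩
  | mul u v _ _ hu hv =>
    obtain ⟨u', hu, hu'⟩ := hu
    obtain ⟨v', hv, hv'⟩ := hv
    refine ⟨u' * v', ?_, by simp [hu', hv', mul_comm]⟩
    rw [Subgroup.coe_mul, hu, hv, Subgroup.coe_mul]
    calc act' e * u.1 * act' e * (act' e * v.1 * act' e)
        = act' e * u.1 * (act' e * act' e) * v.1 * act' e := by group
      _ = _ := by rw [hE]; group
  | inv u _ hu =>
    obtain ⟨u', hu, hu'⟩ := hu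
    refine ⟨u'⁻¹, ?_, by simp [hu']⟩
    simp [hu, h.act'_inv, mul_assoc]

/-- If `a = g e` with `g` in the displacement group, then `L_a L_e⁻¹ = g (L_e g⁻¹ L_e)` has the same
image as `g ^ 2` in the abelianization. -/
theorem exists_sq_eq_abelianization_disGroup (hinv : IsInvolutory Q) (hconn : IsConnected Q)
    (x : Abelianization (disGroup Q)) : ∃ y, y ^ 2 = x := by
  obtain ⟨g, rfl⟩ := QuotientGroup.mk'_surjective _ x
  change ∃ y, y ^ 2 = Abelianization.of g
  have key (e a : Q) : ∃ y, y ^ 2 = Abelianization.of (disGroup.gen a e) := by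
    obtain ⟨g, rfl⟩ := hconn.exists_disGroup e a
    obtain ⟨g', hg', hφ⟩ := hinv.exists_conj_disGroup Abelianization.of e g⁻¹
    have : disGroup.gen (g.1 e) e = g * g' := by
      apply Subtype.ext
      simp [disGroup.gen, hg', act'_perm_apply (disGroup_le_leftMulGroup g.2), hinv.act'_inv,
        mul_assoc]
    exact ⟨Abelianization.of g, by rw [this, map_mul, hφ]; simp [sq]⟩
  have hg : g ∈ Subgroup.closure {g : disGroup Q | ∃ a b : Q, g = disGroup.gen a b} :=
    disGroup.closure_gen (Q := Q) ▸ Subgroup.mem_top g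
  induction hg using Subgroup.closure_induction with
  | mem u hu => obtain ⟨a, b, rfl⟩ := hu; exact key b a
  | one => exact ⟨1, by simp⟩
  | mul u v _ _ hu hv =>
    obtain ⟨y, hy⟩ := hu
    obtain ⟨z, hz⟩ := hv
    exact ⟨y * z, by rw [mul_pow, hy, hz, map_mul]⟩
  | inv u _ hu =>
    obtain ⟨y, hy⟩ := hu
    exact ⟨y⁻¹, by rw [inv_pow, hy, map_inv]⟩

theorem coprime_card_disGroup_two [Finite Q] (hnil : IsNilpotent Q) (hinv : IsInvolutory Q)
    (hconn : IsConnected Q) : (Nat.card (disGroup Q)).Coprime 2 :=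
  have := isNilpotent_disGroup hnil
  Group.coprime_card_of_pow_surjective_abelianization
    (exists_sq_eq_abelianization_disGroup hinv hconn)

theorem IsInvolutory.gen_sq (h : IsInvolutory Q) (a e : Q) :
    disGroup.gen a e ^ 2 = disGroup.gen (a ◃ e) e := by
  apply Subtype.ext
  simp [disGroup.gen, sq, ad_conj, h.act'_inv, mul_assoc]

/-! ### Latin quandles -/

theorem IsLatin.isConnected (h : IsLatin Q) : IsConnected Q where
  exists_smul_eq x y := by
    obtain ⟨c, hc⟩ := (h x).2 y
    exact ⟨⟨act' c, act'_mem_leftMulGroup c⟩, hc⟩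

theorem IsLatin.isFaithful (h : IsLatin Q) : IsFaithful Q := fun a _ hab =>
  (h a).1 (DFunLike.congr_fun hab a)

theorem isLatin_of_isConnected_of_isFaithful [Finite Q] (hnil : IsNilpotent Q)
    (hinv : IsInvolutory Q) (hconn : IsConnected Q) (hfaith : IsFaithful Q) : IsLatin Q := by
  intro e
  refine Finite.injective_iff_bijective.1 fun a b (hab : a ◃ e = b ◃ e) => hfaith ?_
  have hsq : disGroup.gen a e ^ 2 = disGroup.gen b e ^ 2 := by
    rw [hinv.gen_sq, hinv.gen_sq, hab]
  have := (powCoprime (coprime_card_disGroup_two hnil hinv hconn)).injective hsq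
  exact mul_right_cancel (Subtype.ext_iff.1 this)

end Quandle

end Rack

theorem mainTheorem4 (Q : Type*) [Quandle Q] [Finite Q]
    (hnil : Rack.IsNilpotent Q) (hinv : Rack.IsInvolutory Q) :
    Rack.IsLatin Q ↔ Rack.IsConnected Q ∧ Rack.IsFaithful Q :=
  ⟨fun h => ⟨h.isConnected, h.isFaithful⟩,
    fun h => Rack.isLatin_of_isConnected_of_isFaithful hnil hinv h.1 h.2⟩
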